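/- Let $\mathcal{Y}\subset\mathbb{R}^d$ be a finite set whose convex hull $\mathcal{C}=\mathrm{conv}(\mathcal{Y})$ has full dimension in $\mathbb{R}^d$, let $\varphi:\mathbb{R}^d\to\mathbb{R}$ be any function, let $t>0$, and for $\theta\in\mathbb{R}^d$ let $\pi_{\theta,t}$ be the Gibbs distribution on $\mathcal{Y}$, $$\pi_{\theta,t}(y)=\frac{\exp([\langle\theta,y\rangle+\varphi(y)]/t)}{\sum_{y'\in\mathcal{Y}}\exp([\langle\theta,y'\rangle+\varphi(y')]/t)}.$$ Let $A_t(\theta)=t\log\sum_{y\in\mathcal{Y}}\exp([\langle\theta,y\rangle+\varphi(y)]/t)$, let $\Omega_t=A_t^*$ be its Fenchel conjugate (with values in $\mathbb{R}\cup\{+\infty\}$), where $f^*(u)=\sup_{v\in\mathbb{R}^d}\langle u,v\rangle-f(v)$, and let $$\ell_t(\theta;y)=\Omega_t^*(\theta)+\Omega_t(y)-\langle\theta,y\rangle,\qquad L_N(\theta;y_1,\dots,y_N)=\frac1N\sum_{i=1}^N\ell_t(\theta;y_i)$$ be the Fenchel–Young loss and the empirical loss. Fix $\theta_0\in\mathbb{R}^d$,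 let $y_1,y_2,\dots$ be i.i.d. random vectors with law $\pi_{\theta_0,t}$, and let $\bar Y_N=\frac1N\sum_{i=1}^N y_i$. Then: 1. $\mathrm{Cov}_{\pi_{\theta_0,t}}[Y]$ is positive definite. 2. For all $N\ge 1$ and all $u_1,\dots,u_N\in\mathcal{Y}$ with $\frac1N\sum_{i=1}^N u_i\in\mathrm{int}(\mathcal{C})$, the function $\theta\mapsto L_N(\theta;u_1,\dots,u_N)$ has exactly one minimizer over $\mathbb{R}^d$. 3. Almost surely, $\bar Y_N\in\mathrm{int}(\mathcal{C})$ for all sufficiently large $N$. 4. Let $(\theta^\star_N)_N$ be any random vectors in $\mathbb{R}^d$ such that, for each $N\ge1$, almost surely on the event $\{\bar Y_N\in\mathrm{int}(\mathcal{C})\}$, $\theta^\star_N$ minimizes $L_N(\,\cdot\,;y_1,\dots,y_N)$ over $\mathbb{R}^d$ (off this event $\theta^\star_N$ is arbitrary). Then $$\sqrt N\,(\theta^\star_N-\theta_0)\xrightarrow[N\to\infty]{\mathcal{D}}\mathcal{N}\!\left(0,\;t^2\,\mathrm{Cov}_{\pi_{\theta_0,t}}[Y]^{-1}\right).$$ 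-/

import Mathlib

open MeasureTheory ProbabilityTheory Filter Topology

namespace FYGibbs

noncomputable section

/-- The parameter space and ambient output space `ℝ^d` with its Euclidean structure. -/
abbrev Vec (d : ℕ) : Type := EuclideanSpace ℝ (Fin d)

/-- The unnormalized Gibbs weight `exp ((⟨θ, y⟩ + φ y) / t)`. -/
def weight {d : ℕ} (φ : Vec d → ℝ) (t : ℝ) (θ y : Vec d) : ℝ :=
  Real.exp ((inner ℝ θ y + φ y) / t)

/-- The partition function `∑_{y ∈ 𝒴} exp ((⟨θ, y⟩ + φ y) / t)`. -/
def partition {d : ℕ} (𝒴 : Finset (Vec d)) (φ : Vec d → ℝ) (t : ℝ) (θ : Vec d) : ℝ :=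
  ∑ y ∈ 𝒴, weight φ t θ y

/-- The Gibbs distribution `π_{θ,t}` on the finite set `𝒴`, as a measure on `ℝ^d`. -/
def gibbs {d : ℕ} (𝒴 : Finset (Vec d)) (φ : Vec d → ℝ) (t : ℝ) (θ : Vec d) :
    Measure (Vec d) :=
  ∑ y ∈ 𝒴, ENNReal.ofReal (weight φ t θ y / partition 𝒴 φ t θ) • Measure.dirac y

/-- The covariance matrix of a random vector with law `ν`. -/
def covMat {d : ℕ} (ν : Measure (Vec d)) : Matrix (Fin d) (Fin d) ℝ :=
  Matrix.of fun i j => cov[fun y => y i, fun y => y j; ν]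

/-- The scaled cumulant function `A_t θ = t log ∑_{y ∈ 𝒴} exp ((⟨θ, y⟩ + φ y) / t)`. -/
def cumulant {d : ℕ} (𝒴 : Finset (Vec d)) (φ : Vec d → ℝ) (t : ℝ) (θ : Vec d) : ℝ :=
  t * Real.log (partition 𝒴 φ t θ)

/-- The Fenchel conjugate `f* u = sup_v ⟨u, v⟩ - f v` of an extended-real-valued function. -/
def conjugate {d : ℕ} (f : Vec d → EReal) (u : Vec d) : EReal :=
  ⨆ v : Vec d, ((inner ℝ u v : ℝ) : EReal) - f v

/-- The regularizer `Ω_t = A_t*`, with values in the extended reals. -/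
def regularizer {d : ℕ} (𝒴 : Finset (Vec d)) (φ : Vec d → ℝ) (t : ℝ) : Vec d → EReal :=
  conjugate fun θ => (cumulant 𝒴 φ t θ : EReal)

/-- The Fenchel-Young loss `ℓ_t (θ ; y) = Ω_t* θ + Ω_t y - ⟨θ, y⟩`. -/
def fyLoss {d : ℕ} (𝒴 : Finset (Vec d)) (φ : Vec d → ℝ) (t : ℝ) (θ y : Vec d) : EReal :=
  conjugate (regularizer 𝒴 φ t) θ + regularizer 𝒴 φ t y - ((inner ℝ θ y : ℝ) : EReal)

/-- The empirical loss `L_N (θ ; y_1, …, y_N) = (1 / N) ∑ ℓ_t (θ ; y_i)`. -/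
def empLoss {d : ℕ} (𝒴 : Finset (Vec d)) (φ : Vec d → ℝ) (t : ℝ) {N : ℕ}
    (y : Fin N → Vec d) (θ : Vec d) : EReal :=
  (((1 / N : ℝ) : ℝ) : EReal) * ∑ i, fyLoss 𝒴 φ t θ (y i)

/-- `θ` is a (global) minimizer of the empirical loss for the observations `y`. -/
def IsMinimizer {d : ℕ} (𝒴 : Finset (Vec d)) (φ : Vec d → ℝ) (t : ℝ) {N : ℕ}
    (y : Fin N → Vec d) (θ : Vec d) : Prop :=
  ∀ θ' : Vec d, empLoss 𝒴 φ t y θ ≤ empLoss 𝒴 φ t y θ'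

/-- The sample mean `(1 / N) ∑ y_i`. -/
def sampleMean {d N : ℕ} (y : Fin N → Vec d) : Vec d :=
  (1 / N : ℝ) • ∑ i, y i

end

end FYGibbs

/-!
The Fenchel–Young loss reduces the problem to maximum likelihood in an exponential family. The
cumulant `A_t` is convex, with gradient the Gibbs mean `m(θ) = ∑ π_θ(y) y`; the tangent inequality
`cumulant_add_inner_le` is Jensen's inequality in the form `exp x ≥ 1 + x`, and it is strict away
from the point of tangency (`cumulant_add_inner_lt`) because no nonzero linear functional is
constant on a set whose convex hull has full dimension. Hence `Ω_t* = A_t`, and for data in `𝒴` the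
empirical loss is, up to a finite constant, the function `A_t(θ) - ⟨θ, ȳ⟩`
(`exists_empLoss_eq_coe`). Its minimizers are the solutions of the moment equation `m(θ) = ȳ`
(`isMinimizer_iff_gibbsMean_eq`). There is at most one, as `m` is injective, and there is one if
`ȳ` is interior to the convex hull, as the function is then coercive
(`exists_mul_norm_le_cumulant_sub_inner`).

The derivative of `m` at `θ` is `Cov / t`, which is invertible (`posDef_covMat_gibbs`). By the
inverse function theorem `m` is open and has a differentiable local inverse at `θ₀`. Openness puts
`m(θ₀)`, the limit of the sample means by the strong law of large numbers, into the interior of the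
convex hull (`gibbsMean_mem_interior`). The global injectivity of `m` identifies the minimizer with
the image of the sample mean under the local inverse, almost surely for all large `N`. The
multivariate central limit theorem for the sample mean
(`tendstoInDistribution_inv_sqrt_smul_sum_sub`), and the delta method
(`tendstoInDistribution_delta_method`) with derivative `t Cov⁻¹`, then give the limit with
covariance matrix `t² Cov⁻¹ = (t Cov⁻¹) Cov (t Cov⁻¹)`.
-/

namespace FYGibbs

noncomputable section

section

/-! ### Gibbs weights, and the tangent inequality for the cumulant -/

/-- The probability that the Gibbs distribution at `θ` assigns to `y ∈ 𝒴`. -/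
def gibbsProb {d : ℕ} (𝒴 : Finset (Vec d)) (φ : Vec d → ℝ) (t : ℝ) (θ y : Vec d) : ℝ :=
  weight φ t θ y / partition 𝒴 φ t θ

/-- The mean `∑ π_θ(y) y` of the Gibbs distribution, which is also the gradient of the cumulant. -/
def gibbsMean {d : ℕ} (𝒴 : Finset (Vec d)) (φ : Vec d → ℝ) (t : ℝ) (θ : Vec d) : Vec d :=
  ∑ y ∈ 𝒴, gibbsProb 𝒴 φ t θ y • y

variable {d : ℕ} {𝒴 : Finset (Vec d)} {φ : Vec d → ℝ} {t : ℝ}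

lemma nonempty_of_affineSpan_eq_top
    (hfull : affineSpan ℝ (convexHull ℝ (𝒴 : Set (Vec d))) = ⊤) : 𝒴.Nonempty := by
  rw [affineSpan_convexHull] at hfull
  exact_mod_cast (affineSpan_nonempty (k := ℝ) (s := (𝒴 : Set (Vec d)))).1
    (by rw [hfull]; exact ⟨0, trivial⟩)

/-- Full dimension of the convex hull means that no nonzero linear functional is constant
on `𝒴`. -/
lemma eq_zero_of_inner_eq_const (hfull : affineSpan ℝ (convexHull ℝ (𝒴 : Set (Vec d))) = ⊤)
    {v : Vec d} {c : ℝ} (h : ∀ y ∈ 𝒴, inner ℝ v y = c) : v = 0 := by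
  rw [affineSpan_convexHull] at hfull
  have key : ∀ x : Vec d, inner ℝ v x = c := by
    intro x
    have hx : x ∈ affineSpan ℝ (𝒴 : Set (Vec d)) := by rw [hfull]; trivial
    refine affineSpan_induction (p := fun x => inner ℝ v x = c) hx h fun a x₁ x₂ x₃ h₁ h₂ h₃ => ?_
    simp [inner_add_right, inner_sub_right, inner_smul_right, h₁, h₂, h₃]
  have h0 := key 0
  rw [inner_zero_right] at h0
  exact inner_self_eq_zero.1 ((key v).trans h0.symm)

lemma weight_pos (θ y : Vec d) : 0 < weight φ t θ y := Real.exp_pos _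

lemma partition_pos (hne : 𝒴.Nonempty) (θ : Vec d) : 0 < partition 𝒴 φ t θ :=
  Finset.sum_pos (fun _ _ => weight_pos _ _) hne

lemma gibbsProb_pos (hne : 𝒴.Nonempty) (θ y : Vec d) : 0 < gibbsProb 𝒴 φ t θ y :=
  div_pos (weight_pos _ _) (partition_pos hne θ)

lemma sum_gibbsProb (hne : 𝒴.Nonempty) (θ : Vec d) : ∑ y ∈ 𝒴, gibbsProb 𝒴 φ t θ y = 1 := by
  simp only [gibbsProb]
  rw [← Finset.sum_div]
  exact div_self (partition_pos hne θ).ne'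

lemma inner_gibbsMean (θ v : Vec d) :
    inner ℝ v (gibbsMean 𝒴 φ t θ) = ∑ y ∈ 𝒴, gibbsProb 𝒴 φ t θ y * inner ℝ v y := by
  simp [gibbsMean, inner_sum, inner_smul_right]

lemma gibbsMean_mem_convexHull (hne : 𝒴.Nonempty) (θ : Vec d) :
    gibbsMean 𝒴 φ t θ ∈ convexHull ℝ (𝒴 : Set (Vec d)) :=
  (convex_convexHull ℝ _).sum_mem (fun _ _ => (gibbsProb_pos hne _ _).le) (sum_gibbsProb hne θ)
    fun _ hy => subset_convexHull ℝ _ hy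

lemma weight_eq_mul_exp (θ v y : Vec d) :
    weight φ t v y = weight φ t θ y * Real.exp (inner ℝ (v - θ) y / t) := by
  rw [weight, weight, ← Real.exp_add]
  congr 1
  rw [inner_sub_left]
  ring

lemma cumulant_eq_add_log (hne : 𝒴.Nonempty) (θ v : Vec d) :
    cumulant 𝒴 φ t v = cumulant 𝒴 φ t θ +
      t * Real.log (∑ y ∈ 𝒴, gibbsProb 𝒴 φ t θ y * Real.exp (inner ℝ (v - θ) y / t)) := by
  have hp : partition 𝒴 φ t v = partition 𝒴 φ t θ *
      ∑ y ∈ 𝒴, gibbsProb 𝒴 φ t θ y * Real.exp (inner ℝ (v - θ) y / t) := by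
    have hz := (partition_pos (φ := φ) (t := t) hne θ).ne'
    rw [Finset.mul_sum, partition]
    refine Finset.sum_congr rfl fun y _ => ?_
    rw [weight_eq_mul_exp θ v y, gibbsProb, ← mul_assoc, mul_div_cancel₀ _ hz]
  have hs : 0 < ∑ y ∈ 𝒴, gibbsProb 𝒴 φ t θ y * Real.exp (inner ℝ (v - θ) y / t) :=
    Finset.sum_pos (fun y _ => mul_pos (gibbsProb_pos hne _ _) (Real.exp_pos _)) hne
  rw [cumulant, cumulant, hp, Real.log_mul (partition_pos hne θ).ne' hs.ne']
  ring

/-- The exponential moment of the Gibbs distribution, normalized by its mean, is the sum of the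
terms `π_θ(y) exp x_y` whose exponents `x_y` have average zero. -/
lemma sum_gibbsProb_mul_exp (θ w : Vec d) :
    ∑ y ∈ 𝒴, gibbsProb 𝒴 φ t θ y * Real.exp (inner ℝ w y / t) =
      Real.exp (inner ℝ w (gibbsMean 𝒴 φ t θ) / t) * ∑ y ∈ 𝒴, gibbsProb 𝒴 φ t θ y *
        Real.exp ((inner ℝ w y - inner ℝ w (gibbsMean 𝒴 φ t θ)) / t) := by
  rw [Finset.mul_sum]
  refine Finset.sum_congr rfl fun y _ => ?_
  rw [mul_left_comm, ← Real.exp_add]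
  congr 2
  ring

lemma sum_gibbsProb_mul_centered (hne : 𝒴.Nonempty) (θ w : Vec d) :
    ∑ y ∈ 𝒴, gibbsProb 𝒴 φ t θ y *
      ((inner ℝ w y - inner ℝ w (gibbsMean 𝒴 φ t θ)) / t + 1) = 1 := by
  have h1 := sum_gibbsProb (φ := φ) (t := t) hne θ
  have h2 := inner_gibbsMean (𝒴 := 𝒴) (φ := φ) (t := t) θ w
  set m := inner ℝ w (gibbsMean 𝒴 φ t θ)
  calc _ = (∑ y ∈ 𝒴, gibbsProb 𝒴 φ t θ y * inner ℝ w y - (∑ y ∈ 𝒴, gibbsProb 𝒴 φ t θ y) * m) / t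
        + ∑ y ∈ 𝒴, gibbsProb 𝒴 φ t θ y := by
        rw [Finset.sum_mul, ← Finset.sum_sub_distrib, Finset.sum_div, ← Finset.sum_add_distrib]
        exact Finset.sum_congr rfl fun y _ => by ring
    _ = 1 := by rw [← h2, h1]; ring

/-- The tangent inequality for the convex cumulant, with slope the Gibbs mean: Jensen's inequality
in the form `exp x ≥ 1 + x`. -/
lemma cumulant_add_inner_le (hne : 𝒴.Nonempty) (ht : 0 < t) (θ v : Vec d) :
    cumulant 𝒴 φ t θ + inner ℝ (v - θ) (gibbsMean 𝒴 φ t θ) ≤ cumulant 𝒴 φ t v := by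
  rw [cumulant_eq_add_log hne θ v, sum_gibbsProb_mul_exp]
  have h1 : 1 ≤ ∑ y ∈ 𝒴, gibbsProb 𝒴 φ t θ y *
      Real.exp ((inner ℝ (v - θ) y - inner ℝ (v - θ) (gibbsMean 𝒴 φ t θ)) / t) := by
    rw [← sum_gibbsProb_mul_centered (φ := φ) (t := t) hne θ (v - θ)]
    exact Finset.sum_le_sum fun y _ =>
      mul_le_mul_of_nonneg_left (Real.add_one_le_exp _) (gibbsProb_pos hne _ _).le
  rw [Real.log_mul (Real.exp_pos _).ne' (by positivity), Real.log_exp, mul_add,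
    mul_div_cancel₀ _ ht.ne']
  have := mul_nonneg ht.le (Real.log_nonneg h1)
  linarith

/-- The tangent inequality is strict away from the point of tangency, since no nonzero linear
functional is constant on `𝒴`. -/
lemma cumulant_add_inner_lt (hfull : affineSpan ℝ (convexHull ℝ (𝒴 : Set (Vec d))) = ⊤)
    (ht : 0 < t) {θ v : Vec d} (hv : v ≠ θ) :
    cumulant 𝒴 φ t θ + inner ℝ (v - θ) (gibbsMean 𝒴 φ t θ) < cumulant 𝒴 φ t v := by
  have hne := nonempty_of_affineSpan_eq_top hfull
  rw [cumulant_eq_add_log hne θ v, sum_gibbsProb_mul_exp]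
  have h1 : 1 < ∑ y ∈ 𝒴, gibbsProb 𝒴 φ t θ y *
      Real.exp ((inner ℝ (v - θ) y - inner ℝ (v - θ) (gibbsMean 𝒴 φ t θ)) / t) := by
    rw [← sum_gibbsProb_mul_centered (φ := φ) (t := t) hne θ (v - θ)]
    obtain ⟨y, hy, hyne⟩ : ∃ y ∈ 𝒴,
        inner ℝ (v - θ) y ≠ inner ℝ (v - θ) (gibbsMean 𝒴 φ t θ) := by
      by_contra! hcon
      exact hv (sub_eq_zero.1 (eq_zero_of_inner_eq_const hfull hcon))
    exact Finset.sum_lt_sum (fun y _ =>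
      mul_le_mul_of_nonneg_left (Real.add_one_le_exp _) (gibbsProb_pos hne _ _).le)
      ⟨y, hy, mul_lt_mul_of_pos_left
        (Real.add_one_lt_exp (div_ne_zero (sub_ne_zero.2 hyne) ht.ne')) (gibbsProb_pos hne _ _)⟩
  rw [Real.log_mul (Real.exp_pos _).ne' (by positivity), Real.log_exp, mul_add,
    mul_div_cancel₀ _ ht.ne']
  have := mul_pos ht (Real.log_pos h1)
  linarith

lemma inner_add_le_cumulant (ht : 0 < t) (θ : Vec d) {y : Vec d} (hy : y ∈ 𝒴) :
    inner ℝ θ y + φ y ≤ cumulant 𝒴 φ t θ := by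
  have h : weight φ t θ y ≤ partition 𝒴 φ t θ :=
    Finset.single_le_sum (f := fun y => weight φ t θ y) (fun _ _ => (weight_pos _ _).le) hy
  have h2 := Real.log_le_log (weight_pos _ _) h
  rw [weight, Real.log_exp, div_le_iff₀' ht] at h2
  exact h2

lemma gibbsMean_injective (hfull : affineSpan ℝ (convexHull ℝ (𝒴 : Set (Vec d))) = ⊤)
    (ht : 0 < t) : Function.Injective (gibbsMean 𝒴 φ t) := by
  intro θ v h
  by_contra hne
  have h1 := cumulant_add_inner_lt (φ := φ) hfull ht (Ne.symm hne)
  have h2 := cumulant_add_inner_lt (φ := φ) hfull ht hne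
  rw [← h] at h2
  rw [inner_sub_left] at h1 h2
  linarith

/-! ### Fenchel conjugates and the empirical loss -/

lemma regularizer_ne_bot (u : Vec d) : regularizer 𝒴 φ t u ≠ ⊥ := by
  intro h
  have := le_iSup (fun v : Vec d => ((inner ℝ u v : ℝ) : EReal) - (cumulant 𝒴 φ t v : EReal)) 0
  rw [regularizer, conjugate] at h
  rw [h, le_bot_iff, ← EReal.coe_sub] at this
  exact EReal.coe_ne_bot _ this

lemma regularizer_gibbsMean_le (hne : 𝒴.Nonempty) (ht : 0 < t) (θ : Vec d) :
    regularizer 𝒴 φ t (gibbsMean 𝒴 φ t θ) ≤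
      ((inner ℝ θ (gibbsMean 𝒴 φ t θ) - cumulant 𝒴 φ t θ : ℝ) : EReal) := by
  refine iSup_le fun v => ?_
  rw [← EReal.coe_sub, EReal.coe_le_coe_iff]
  have := cumulant_add_inner_le (φ := φ) hne ht θ v
  rw [inner_sub_left] at this
  rw [real_inner_comm]
  linarith

/-- On `𝒴` the regularizer is finite: it lies between `-A_t(0)` and `-φ y`. -/
lemma exists_regularizer_eq_coe (ht : 0 < t) {y : Vec d} (hy : y ∈ 𝒴) :
    ∃ r : ℝ, regularizer 𝒴 φ t y = r := by
  have hle : regularizer 𝒴 φ t y ≤ ((-φ y : ℝ) : EReal) := by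
    refine iSup_le fun v => ?_
    rw [← EReal.coe_sub, EReal.coe_le_coe_iff]
    have := inner_add_le_cumulant (φ := φ) ht v hy
    rw [real_inner_comm] at this
    linarith
  have htop : regularizer 𝒴 φ t y ≠ ⊤ := fun h => by
    rw [h, top_le_iff] at hle
    exact EReal.coe_ne_top _ hle
  exact ⟨_, (EReal.coe_toReal htop (regularizer_ne_bot y)).symm⟩

/-- Biconjugation: the supremum defining `Ω_t*` at `θ` is attained at the Gibbs mean. -/
lemma conjugate_regularizer (hne : 𝒴.Nonempty) (ht : 0 < t) (θ : Vec d) :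
    conjugate (regularizer 𝒴 φ t) θ = cumulant 𝒴 φ t θ := by
  refine le_antisymm (iSup_le fun u => ?_) ?_
  · have h : ((inner ℝ u θ : ℝ) : EReal) - (cumulant 𝒴 φ t θ : EReal) ≤ regularizer 𝒴 φ t u :=
      le_iSup (fun v : Vec d => ((inner ℝ u v : ℝ) : EReal) - (cumulant 𝒴 φ t v : EReal)) θ
    have hb := regularizer_ne_bot (𝒴 := 𝒴) (φ := φ) (t := t) u
    revert h hb
    induction regularizer 𝒴 φ t u using EReal.rec with
    | bot => simp
    | top => simp
    | coe r =>
      intro h _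
      norm_cast at h ⊢
      rw [real_inner_comm]
      linarith
  · refine le_trans ?_ (le_iSup (fun u : Vec d =>
      ((inner ℝ θ u : ℝ) : EReal) - regularizer 𝒴 φ t u) (gibbsMean 𝒴 φ t θ))
    calc (cumulant 𝒴 φ t θ : EReal) = ((inner ℝ θ (gibbsMean 𝒴 φ t θ) : ℝ) : EReal) -
          ((inner ℝ θ (gibbsMean 𝒴 φ t θ) - cumulant 𝒴 φ t θ : ℝ) : EReal) := by
          norm_cast; ring
      _ ≤ _ := EReal.sub_le_sub le_rfl (regularizer_gibbsMean_le hne ht θ)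

/-- Up to an additive constant, the empirical loss at data in `𝒴` is
`A_t(θ) - ⟨θ, ȳ⟩`. -/
lemma exists_empLoss_eq_coe (hne : 𝒴.Nonempty) (ht : 0 < t) {N : ℕ} (hN : 0 < N)
    {u : Fin N → Vec d} (hu : ∀ i, u i ∈ 𝒴) :
    ∃ c : ℝ, ∀ θ, empLoss 𝒴 φ t u θ =
      ((cumulant 𝒴 φ t θ - inner ℝ θ (sampleMean u) + c : ℝ) : EReal) := by
  choose r hr using fun i => exists_regularizer_eq_coe (φ := φ) ht (hu i)
  refine ⟨(1 / N : ℝ) * ∑ i, r i, fun θ => ?_⟩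
  have h : ∀ i, fyLoss 𝒴 φ t θ (u i) =
      ((cumulant 𝒴 φ t θ + r i - inner ℝ θ (u i) : ℝ) : EReal) := fun i => by
    rw [fyLoss, conjugate_regularizer hne ht, hr]
    norm_cast
  have hN' : (N : ℝ) ≠ 0 := by positivity
  have hsum : ∀ f : Fin N → ℝ, ((∑ i, f i : ℝ) : EReal) = ∑ i, (f i : EReal) := fun f =>
    map_sum (⟨⟨Real.toEReal, EReal.coe_zero⟩, EReal.coe_add⟩ : ℝ →+ EReal) f Finset.univ
  rw [empLoss, Finset.sum_congr rfl fun i _ => h i, ← hsum, ← EReal.coe_mul]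
  congr 1
  rw [sampleMean, inner_smul_right, inner_sum, Finset.sum_sub_distrib, Finset.sum_add_distrib]
  simp only [Finset.sum_const, Finset.card_univ, Fintype.card_fin, nsmul_eq_mul]
  field_simp
  ring

lemma isMinimizer_iff (hne : 𝒴.Nonempty) (ht : 0 < t) {N : ℕ} (hN : 0 < N)
    {u : Fin N → Vec d} (hu : ∀ i, u i ∈ 𝒴) {θ : Vec d} :
    IsMinimizer 𝒴 φ t u θ ↔ ∀ θ' : Vec d, cumulant 𝒴 φ t θ - inner ℝ θ (sampleMean u) ≤
      cumulant 𝒴 φ t θ' - inner ℝ θ' (sampleMean u) := by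
  obtain ⟨c, hc⟩ := exists_empLoss_eq_coe (φ := φ) hne ht hN hu
  simp only [IsMinimizer, hc, EReal.coe_le_coe_iff, add_le_add_iff_right]

/-! ### Derivatives of the cumulant and of the Gibbs mean -/

lemma hasStrictFDerivAt_weight (θ y : Vec d) :
    HasStrictFDerivAt (fun θ => weight φ t θ y) ((weight φ t θ y / t) • innerSL ℝ y) θ := by
  have h1 : HasStrictFDerivAt (fun θ : Vec d => (inner ℝ y θ + φ y) / t)
      (t⁻¹ • innerSL ℝ y) θ := by
    simp only [div_eq_inv_mul]
    exact (((innerSL ℝ y).hasStrictFDerivAt).add_const (φ y)).const_mul t⁻¹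
  have h2 := h1.exp
  simp only [weight, real_inner_comm y]
  rw [div_eq_mul_inv, mul_smul]
  exact h2

lemma hasStrictFDerivAt_partition (hne : 𝒴.Nonempty) (θ : Vec d) :
    HasStrictFDerivAt (partition 𝒴 φ t)
      ((partition 𝒴 φ t θ / t) • innerSL ℝ (gibbsMean 𝒴 φ t θ)) θ := by
  have h := HasStrictFDerivAt.fun_sum (u := 𝒴)
    fun y _ => hasStrictFDerivAt_weight (φ := φ) (t := t) θ y
  refine h.congr_fderiv ?_
  ext v
  have hz := (partition_pos (φ := φ) (t := t) hne θ).ne'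
  simp only [sum_apply, smul_apply, innerSL_apply_apply,
    smul_eq_mul, real_inner_comm v, inner_gibbsMean, Finset.mul_sum, gibbsProb]
  refine Finset.sum_congr rfl fun y _ => ?_
  field_simp

/-- The gradient of the cumulant is the Gibbs mean. -/
lemma hasFDerivAt_cumulant (hne : 𝒴.Nonempty) (ht : 0 < t) (θ : Vec d) :
    HasFDerivAt (cumulant 𝒴 φ t) (innerSL ℝ (gibbsMean 𝒴 φ t θ)) θ := by
  have hz := (partition_pos (φ := φ) (t := t) hne θ).ne'
  have h := (((hasStrictFDerivAt_partition (φ := φ) (t := t) hne θ).hasFDerivAt).log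
    hz).const_mul t
  refine h.congr_fderiv ?_
  rw [smul_smul, smul_smul]
  field_simp
  simp

/-- The data enter the minimization only through the moment equation `∇A_t(θ) = ȳ`. -/
lemma isMinimizer_iff_gibbsMean_eq (hne : 𝒴.Nonempty) (ht : 0 < t) {N : ℕ} (hN : 0 < N)
    {u : Fin N → Vec d} (hu : ∀ i, u i ∈ 𝒴) {θ : Vec d} :
    IsMinimizer 𝒴 φ t u θ ↔ gibbsMean 𝒴 φ t θ = sampleMean u := by
  rw [isMinimizer_iff hne ht hN hu]
  constructor
  · intro h
    have hd : HasFDerivAt (fun θ => cumulant 𝒴 φ t θ - inner ℝ (sampleMean u) θ)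
        (innerSL ℝ (gibbsMean 𝒴 φ t θ) - innerSL ℝ (sampleMean u)) θ :=
      (hasFDerivAt_cumulant hne ht θ).sub (innerSL ℝ (sampleMean u)).hasFDerivAt
    have hmin : IsLocalMin (fun θ => cumulant 𝒴 φ t θ - inner ℝ (sampleMean u) θ) θ :=
      Eventually.of_forall fun θ' => by
        simpa only [real_inner_comm (sampleMean u)] using h θ'
    have h0 := hmin.hasFDerivAt_eq_zero hd
    rw [← map_sub] at h0
    have h1 := congrArg (fun L => L (gibbsMean 𝒴 φ t θ - sampleMean u)) h0
    simp only [innerSL_apply_apply, zero_apply, inner_self_eq_zero] at h1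
    exact sub_eq_zero.1 h1
  · intro h θ'
    have := cumulant_add_inner_le (φ := φ) hne ht θ θ'
    rw [h, inner_sub_left] at this
    linarith

/-- The derivative of the Gibbs mean is the covariance operator of the Gibbs distribution,
divided by `t`. -/
lemma hasStrictFDerivAt_gibbsMean (hne : 𝒴.Nonempty) (θ : Vec d) :
    HasStrictFDerivAt (gibbsMean 𝒴 φ t)
      (∑ y ∈ 𝒴, (gibbsProb 𝒴 φ t θ y / t) •
        (innerSL ℝ (y - gibbsMean 𝒴 φ t θ)).smulRight y) θ := by
  have hz := (partition_pos (φ := φ) (t := t) hne θ).ne'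
  have h := HasStrictFDerivAt.fun_sum (u := 𝒴) fun y _ =>
    ((hasStrictFDerivAt_weight (φ := φ) (t := t) θ y).mul
      ((hasStrictDerivAt_inv hz).comp_hasStrictFDerivAt θ
        (hasStrictFDerivAt_partition (φ := φ) (t := t) hne θ))).smul_const y
  have he : gibbsMean 𝒴 φ t = fun θ => ∑ y ∈ 𝒴,
      (weight φ t θ y * (Inv.inv ∘ partition 𝒴 φ t) θ) • y := by
    ext1 θ
    simp [gibbsMean, gibbsProb, div_eq_mul_inv]
  rw [he]
  refine h.congr_fderiv ?_
  rw [← he]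
  refine Finset.sum_congr rfl fun y _ => ?_
  ext1 v
  simp only [ContinuousLinearMap.smulRight_apply, add_apply,
    smul_apply, innerSL_apply_apply, smul_eq_mul, smul_smul, inner_sub_left,
    Function.comp_apply, gibbsProb]
  congr 1
  field_simp
  ring

/-! ### Existence and uniqueness of the minimizer -/

/-- If `ȳ` is interior to the convex hull, then `θ ↦ A_t(θ) - ⟨θ, ȳ⟩` grows at least linearly. -/
lemma exists_mul_norm_le_cumulant_sub_inner (hne : 𝒴.Nonempty) (ht : 0 < t) {b : Vec d}
    (hb : b ∈ interior (convexHull ℝ (𝒴 : Set (Vec d)))) :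
    ∃ r > 0, ∃ M : ℝ, ∀ θ, r * ‖θ‖ - M ≤ cumulant 𝒴 φ t θ - inner ℝ θ b := by
  obtain ⟨ε, hε, hball⟩ := Metric.isOpen_iff.1 isOpen_interior b hb
  obtain ⟨M, hM⟩ : ∃ M : ℝ, ∀ y ∈ 𝒴, -M ≤ φ y :=
    ⟨-(𝒴.inf' hne φ), fun y hy => by rw [neg_neg]; exact Finset.inf'_le _ hy⟩
  refine ⟨ε / 2, by positivity, M, fun θ => ?_⟩
  have hlin : ∀ x ∈ convexHull ℝ (𝒴 : Set (Vec d)), inner ℝ θ x - M ≤ cumulant 𝒴 φ t θ := by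
    intro x hx
    have hc : Convex ℝ {x : Vec d | inner ℝ θ x - M ≤ cumulant 𝒴 φ t θ} := by
      simp only [sub_le_iff_le_add]
      exact convex_halfSpace_le (innerSL ℝ θ).isBoundedLinearMap.toIsLinearMap _
    refine convexHull_min (fun y hy => ?_) hc hx
    have := inner_add_le_cumulant (φ := φ) ht θ hy
    have := hM y hy
    simp only [Set.mem_ofPred_eq]
    linarith
  rcases eq_or_ne θ 0 with rfl | hθ
  · have := hlin b (interior_subset hb)
    simp only [norm_zero, inner_zero_left] at this ⊢
    linarith
  have hpos : 0 < ‖θ‖ := norm_pos_iff.2 hθ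
  -- Moving from `b` by `ε / 2` in the direction of `θ` stays in the hull and gains `ε / 2 * ‖θ‖`.
  have hmem : b + (ε / 2 / ‖θ‖) • θ ∈ Metric.ball b ε := by
    rw [Metric.mem_ball, dist_eq_norm, add_sub_cancel_left, norm_smul, Real.norm_of_nonneg
      (by positivity), div_mul_cancel₀ _ hpos.ne']
    linarith
  have h := hlin _ (interior_subset (hball hmem))
  rw [inner_add_right, inner_smul_right, real_inner_self_eq_norm_sq] at h
  have he : ε / 2 / ‖θ‖ * ‖θ‖ ^ 2 = ε / 2 * ‖θ‖ := by field_simp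
  rw [he] at h
  linarith

lemma exists_forall_cumulant_sub_inner_le (hne : 𝒴.Nonempty) (ht : 0 < t) {b : Vec d}
    (hb : b ∈ interior (convexHull ℝ (𝒴 : Set (Vec d)))) : ∃ θ, ∀ θ',
      cumulant 𝒴 φ t θ - inner ℝ θ b ≤ cumulant 𝒴 φ t θ' - inner ℝ θ' b := by
  obtain ⟨r, hr, M, h⟩ := exists_mul_norm_le_cumulant_sub_inner (φ := φ) hne ht hb
  have hcont : Continuous fun θ => cumulant 𝒴 φ t θ - inner ℝ θ b :=
    (continuous_iff_continuousAt.2 fun θ => (hasFDerivAt_cumulant hne ht θ).continuousAt).sub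
      (by fun_prop)
  refine hcont.exists_forall_le (tendsto_atTop_mono h ?_)
  exact tendsto_atTop_add_const_right _ (-M)
    ((tendsto_norm_cocompact_atTop).const_mul_atTop hr)

theorem existsUnique_isMinimizer
    (hfull : affineSpan ℝ (convexHull ℝ (𝒴 : Set (Vec d))) = ⊤) (ht : 0 < t) {N : ℕ} (hN : 0 < N)
    {u : Fin N → Vec d} (hu : ∀ i, u i ∈ 𝒴)
    (hint : sampleMean u ∈ interior (convexHull ℝ (𝒴 : Set (Vec d)))) :
    ∃! θ : Vec d, IsMinimizer 𝒴 φ t u θ := by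
  have hne := nonempty_of_affineSpan_eq_top hfull
  obtain ⟨θ, hθ⟩ := exists_forall_cumulant_sub_inner_le (φ := φ) hne ht hint
  refine ⟨θ, (isMinimizer_iff hne ht hN hu).2 hθ, fun θ' hθ' =>
    gibbsMean_injective (φ := φ) hfull ht ?_⟩
  rw [(isMinimizer_iff_gibbsMean_eq hne ht hN hu).1 hθ',
    (isMinimizer_iff_gibbsMean_eq hne ht hN hu).1 ((isMinimizer_iff hne ht hN hu).2 hθ)]

end

section

/-! ### The central limit theorem for random vectors -/

lemma dotProduct_covMat_mulVec {d : ℕ} {ν : Measure (Vec d)} [IsFiniteMeasure ν]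
    (hν : MemLp id 2 ν) (x : Vec d) :
    dotProduct x.ofLp ((covMat ν).mulVec x) = Var[fun u => inner ℝ x u; ν] := by
  have hcoord : ∀ i, MemLp (fun u : Vec d => u i) 2 ν := fun i => hν.eval_piLp i
  have h := covarianceBilin_apply_pi hcoord x x
  have hid : (fun ω : Vec d => WithLp.toLp 2 fun i => ω i) = id := rfl
  rw [hid, Measure.map_id, covarianceBilin_self hν] at h
  rw [h]
  simp only [dotProduct, Matrix.mulVec, covMat, Matrix.of_apply, Finset.mul_sum]
  exact Finset.sum_congr rfl fun i _ => Finset.sum_congr rfl fun j _ => by ring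

lemma posSemidef_covMat {d : ℕ} {ν : Measure (Vec d)} [IsFiniteMeasure ν] (hν : MemLp id 2 ν) :
    (covMat ν).PosSemidef := by
  refine Matrix.PosSemidef.of_dotProduct_mulVec_nonneg ?_ fun x => ?_
  · ext i j
    simp only [Matrix.conjTranspose_apply, covMat, Matrix.of_apply, star_trivial]
    exact covariance_comm _ _
  · have h := dotProduct_covMat_mulVec hν (WithLp.toLp 2 x)
    rw [star_trivial]
    exact h ▸ variance_nonneg _ _

/-- Multivariate central limit theorem. By Lévy's theorem it suffices to look at characteristic
functions, which reduces the claim to the one-dimensional theorem along each direction. -/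
theorem tendstoInDistribution_inv_sqrt_smul_sum_sub {d : ℕ} {Ω : Type*} [MeasurableSpace Ω]
    {P : Measure Ω} [IsProbabilityMeasure P] {ν : Measure (Vec d)} [IsProbabilityMeasure ν]
    {X : ℕ → Ω → Vec d} (hX : ∀ i, Measurable (X i)) (hindep : iIndepFun X P)
    (hlaw : ∀ i, P.map (X i) = ν) (hν : MemLp id 2 ν) :
    TendstoInDistribution
      (fun (n : ℕ) ω => (√(n : ℝ))⁻¹ • (∑ k ∈ Finset.range n, X k ω - (n : ℝ) • ∫ x, x ∂ν))
      atTop (id : Vec d → Vec d) (fun _ => P) (multivariateGaussian 0 (covMat ν)) where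
  forall_aemeasurable n := by fun_prop
  aemeasurable_limit := aemeasurable_id
  tendsto := by
    refine ProbabilityMeasure.tendsto_iff_tendsto_charFun.2 fun x => ?_
    have hS := posSemidef_covMat hν
    have hlin : Measurable fun u : Vec d => inner ℝ x u := by fun_prop
    have hmem : MemLp (fun u : Vec d => inner ℝ x u) 2 ν := hν.const_inner x
    have hvar : Var[fun ω => inner ℝ x (X 0 ω); P] = dotProduct x.ofLp ((covMat ν).mulVec x) := by
      rw [dotProduct_covMat_mulVec hν, ← hlaw 0, variance_map hlin.aemeasurable (hX 0).aemeasurable]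
      rfl
    have hmean : ∫ ω, inner ℝ x (X 0 ω) ∂P = inner ℝ x (∫ u, u ∂ν) := by
      rw [← integral_inner (f := fun u : Vec d => u) (hν.integrable (by norm_num)) x, ← hlaw 0,
        integral_map (hX 0).aemeasurable hlin.aestronglyMeasurable]
    have hmem0 : MemLp (fun ω => inner ℝ x (X 0 ω)) 2 P := by
      rw [← hlaw 0] at hmem
      exact hmem.comp_of_map (hX 0).aemeasurable
    have hid : ∀ i, IdentDistrib (X i) (X 0) P P := fun i =>
      ⟨(hX i).aemeasurable, (hX 0).aemeasurable, by rw [hlaw, hlaw]⟩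
    have hclt := tendstoInDistribution_inv_sqrt_mul_sum_sub (X := fun i ω => inner ℝ x (X i ω))
      (Y := id) (P' := gaussianReal 0 (Var[fun ω => inner ℝ x (X 0 ω); P]).toNNReal)
      HasLaw.id hmem0 (hindep.comp (fun _ u => inner ℝ x u) fun _ => hlin)
      (fun i => (hid i).comp hlin)
    have h1 := ProbabilityMeasure.tendsto_iff_tendsto_charFun.1 hclt.tendsto 1
    simp only [ProbabilityMeasure.coe_mk, Measure.map_id, charFun_gaussianReal] at h1 ⊢
    rw [charFun_multivariateGaussian hS]
    rw [hvar, Real.coe_toNNReal _ (hvar ▸ variance_nonneg _ _)] at h1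
    have hlim : Complex.exp ((1 : ℝ) * (0 : ℝ) * Complex.I -
          ((dotProduct x.ofLp ((covMat ν).mulVec x) : ℝ) : ℂ) * ((1 : ℝ) : ℂ) ^ 2 / 2) =
        Complex.exp ((inner ℝ x (0 : Vec d) : ℝ) * Complex.I -
          ((dotProduct x.ofLp ((covMat ν).mulVec x) : ℝ) : ℂ) / 2) := by
      simp
    rw [hlim] at h1
    refine h1.congr fun n => ?_
    have hm : Measurable fun ω => (√(n : ℝ))⁻¹ • (∑ k ∈ Finset.range n, X k ω
        - (n : ℝ) • ∫ x, x ∂ν) := by fun_prop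
    rw [charFun_apply, charFun_apply, integral_map hm.aemeasurable (by fun_prop),
      integral_map (hclt.forall_aemeasurable n) (by fun_prop)]
    refine integral_congr_ae (Eventually.of_forall fun ω => ?_)
    simp only [hmean]
    congr 3
    rw [real_inner_comm x, inner_smul_right, inner_sub_right, inner_sum, inner_smul_right]
    simp

/-! ### Moments of the Gibbs distribution -/

variable {d : ℕ} {𝒴 : Finset (Vec d)} {φ : Vec d → ℝ} {t : ℝ}

lemma gibbs_eq_sum (θ : Vec d) :
    gibbs 𝒴 φ t θ = ∑ y ∈ 𝒴, ENNReal.ofReal (gibbsProb 𝒴 φ t θ y) • Measure.dirac y := rfl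

lemma isProbabilityMeasure_gibbs (hne : 𝒴.Nonempty) (θ : Vec d) :
    IsProbabilityMeasure (gibbs 𝒴 φ t θ) := by
  constructor
  have h := sum_gibbsProb (φ := φ) (t := t) hne θ
  simp only [gibbs_eq_sum, Measure.coe_finsetSum, Finset.sum_apply, Measure.smul_apply,
    measure_univ, smul_eq_mul, mul_one]
  rw [← ENNReal.ofReal_sum_of_nonneg fun y _ => (gibbsProb_pos hne θ y).le, h, ENNReal.ofReal_one]

lemma ae_mem_gibbs (θ : Vec d) : ∀ᵐ y ∂gibbs 𝒴 φ t θ, y ∈ 𝒴 := by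
  rw [gibbs_eq_sum, ae_finsetSum_measure_iff]
  intro y hy
  exact Measure.ae_smul_measure ((ae_dirac_iff 𝒴.measurableSet).2 hy) _

lemma integral_gibbs (hne : 𝒴.Nonempty) {E : Type*} [NormedAddCommGroup E] [NormedSpace ℝ E]
    [CompleteSpace E] (θ : Vec d) (f : Vec d → E) :
    ∫ y, f y ∂gibbs 𝒴 φ t θ = ∑ y ∈ 𝒴, gibbsProb 𝒴 φ t θ y • f y := by
  rw [gibbs_eq_sum, integral_finsetSum_measure
    fun y _ => (integrable_dirac (by simp)).smul_measure (by simp)]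
  refine Finset.sum_congr rfl fun y _ => ?_
  rw [integral_smul_measure, integral_dirac,
    ENNReal.toReal_ofReal (gibbsProb_pos hne θ y).le]

lemma memLp_id_gibbs (hne : 𝒴.Nonempty) (θ : Vec d) : MemLp id 2 (gibbs 𝒴 φ t θ) := by
  have := isProbabilityMeasure_gibbs (φ := φ) (t := t) hne θ
  refine MemLp.of_bound aestronglyMeasurable_id (∑ y ∈ 𝒴, ‖y‖) ?_
  filter_upwards [ae_mem_gibbs θ] with y hy
  exact Finset.single_le_sum (f := fun y : Vec d => ‖y‖) (fun _ _ => norm_nonneg _) hy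

lemma integral_id_gibbs (hne : 𝒴.Nonempty) (θ : Vec d) :
    ∫ y, y ∂gibbs 𝒴 φ t θ = gibbsMean 𝒴 φ t θ :=
  integral_gibbs hne θ _

lemma covMat_gibbs_apply (hne : 𝒴.Nonempty) (θ : Vec d) (i j : Fin d) :
    covMat (gibbs 𝒴 φ t θ) i j = ∑ y ∈ 𝒴, gibbsProb 𝒴 φ t θ y *
      ((y i - gibbsMean 𝒴 φ t θ i) * (y j - gibbsMean 𝒴 φ t θ j)) := by
  have hm : ∀ i, ∫ y, y i ∂gibbs 𝒴 φ t θ = gibbsMean 𝒴 φ t θ i := fun i => by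
    rw [integral_gibbs hne]
    simp [gibbsMean]
  rw [covMat, Matrix.of_apply, covariance, integral_gibbs hne, hm, hm]
  simp only [smul_eq_mul]

/-- The covariance operator is `v ↦ ∑ π(y) ⟨y - m, v⟩ y`, because `⟨y - m, v⟩` averages to zero. -/
lemma toEuclideanCLM_covMat_gibbs (hne : 𝒴.Nonempty) (θ v : Vec d) :
    Matrix.toEuclideanCLM (n := Fin d) (𝕜 := ℝ) (covMat (gibbs 𝒴 φ t θ)) v =
      ∑ y ∈ 𝒴, (gibbsProb 𝒴 φ t θ y * inner ℝ (y - gibbsMean 𝒴 φ t θ) v) • y := by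
  have h0 : ∑ y ∈ 𝒴, gibbsProb 𝒴 φ t θ y * inner ℝ (y - gibbsMean 𝒴 φ t θ) v = 0 := by
    simp only [inner_sub_left, mul_sub, Finset.sum_sub_distrib, ← Finset.sum_mul]
    rw [sum_gibbsProb hne, one_mul, sub_eq_zero]
    simp only [real_inner_comm v, inner_gibbsMean]
  ext i
  rw [Matrix.ofLp_toEuclideanCLM]
  have h1 : ∀ y ∈ 𝒴, ∑ j, gibbsProb 𝒴 φ t θ y *
      ((y i - gibbsMean 𝒴 φ t θ i) * (y j - gibbsMean 𝒴 φ t θ j)) * v j =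
      gibbsProb 𝒴 φ t θ y * inner ℝ (y - gibbsMean 𝒴 φ t θ) v * y i -
      gibbsProb 𝒴 φ t θ y * inner ℝ (y - gibbsMean 𝒴 φ t θ) v * gibbsMean 𝒴 φ t θ i := by
    intro y _
    rw [← mul_sub, PiLp.inner_apply, Finset.mul_sum, Finset.sum_mul]
    refine Finset.sum_congr rfl fun j _ => ?_
    simp
    ring
  simp only [Matrix.mulVec, dotProduct, covMat_gibbs_apply hne, Finset.sum_mul]
  rw [Finset.sum_comm, Finset.sum_congr rfl h1, Finset.sum_sub_distrib, ← Finset.sum_mul, h0,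
    zero_mul, sub_zero]
  simp

theorem posDef_covMat_gibbs (hfull : affineSpan ℝ (convexHull ℝ (𝒴 : Set (Vec d))) = ⊤)
    (θ : Vec d) : (covMat (gibbs 𝒴 φ t θ)).PosDef := by
  have hne := nonempty_of_affineSpan_eq_top hfull
  have := isProbabilityMeasure_gibbs (φ := φ) (t := t) hne θ
  have hmem := memLp_id_gibbs (φ := φ) (t := t) hne θ
  refine Matrix.PosDef.of_dotProduct_mulVec_pos (posSemidef_covMat hmem).1 fun x hx => ?_
  have h := dotProduct_covMat_mulVec hmem (WithLp.toLp 2 x)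
  rw [star_trivial]
  refine h ▸ ?_
  rw [variance_eq_integral (by fun_prop), integral_gibbs hne]
  obtain ⟨y, hy, hyne⟩ : ∃ y ∈ 𝒴, inner ℝ (WithLp.toLp 2 x) y ≠
      ∫ u, inner ℝ (WithLp.toLp 2 x) u ∂gibbs 𝒴 φ t θ := by
    by_contra! hcon
    exact hx (congrArg WithLp.ofLp (eq_zero_of_inner_eq_const hfull hcon))
  exact Finset.sum_pos' (fun y _ => mul_nonneg (gibbsProb_pos hne θ y).le (sq_nonneg _))
    ⟨y, hy, mul_pos (gibbsProb_pos hne θ y) (by have := sub_ne_zero.2 hyne; positivity)⟩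

/-- The derivative of the Gibbs mean, as an invertible operator: its inverse is
`t Cov⁻¹`. -/
def covEquiv (hfull : affineSpan ℝ (convexHull ℝ (𝒴 : Set (Vec d))) = ⊤) (φ : Vec d → ℝ)
    (ht : 0 < t) (θ : Vec d) : Vec d ≃L[ℝ] Vec d :=
  ContinuousLinearEquiv.equivOfInverse
    (t⁻¹ • Matrix.toEuclideanCLM (n := Fin d) (𝕜 := ℝ) (covMat (gibbs 𝒴 φ t θ)))
    (t • Matrix.toEuclideanCLM (n := Fin d) (𝕜 := ℝ) (covMat (gibbs 𝒴 φ t θ))⁻¹)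
    (fun v => by
      have hu := (Matrix.isUnit_iff_isUnit_det _).1
        (posDef_covMat_gibbs (φ := φ) (t := t) hfull θ).isUnit
      simp only [smul_apply, map_smul, smul_smul]
      rw [← mul_apply_eq_comp, ← map_mul, Matrix.nonsing_inv_mul _ hu, map_one,
        inv_mul_cancel₀ ht.ne', one_smul]
      rfl)
    (fun v => by
      have hu := (Matrix.isUnit_iff_isUnit_det _).1
        (posDef_covMat_gibbs (φ := φ) (t := t) hfull θ).isUnit
      simp only [smul_apply, map_smul, smul_smul]
      rw [← mul_apply_eq_comp, ← map_mul, Matrix.mul_nonsing_inv _ hu, map_one,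
        mul_inv_cancel₀ ht.ne', one_smul]
      rfl)

lemma hasStrictFDerivAt_gibbsMean_covEquiv
    (hfull : affineSpan ℝ (convexHull ℝ (𝒴 : Set (Vec d))) = ⊤) (ht : 0 < t) (θ : Vec d) :
    HasStrictFDerivAt (gibbsMean 𝒴 φ t) (covEquiv hfull φ ht θ : Vec d →L[ℝ] Vec d) θ := by
  have hne := nonempty_of_affineSpan_eq_top hfull
  refine (hasStrictFDerivAt_gibbsMean hne θ).congr_fderiv ?_
  ext1 v
  change _ = t⁻¹ • Matrix.toEuclideanCLM (n := Fin d) (𝕜 := ℝ) (covMat (gibbs 𝒴 φ t θ)) v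
  rw [toEuclideanCLM_covMat_gibbs hne, Finset.smul_sum, sum_apply]
  refine Finset.sum_congr rfl fun y _ => ?_
  simp only [smul_apply, ContinuousLinearMap.smulRight_apply, innerSL_apply_apply, smul_smul]
  congr 1
  ring

/-- The Gibbs mean is interior to the convex hull: by the inverse function theorem the map
`θ ↦ m(θ)`, which takes values in the convex hull, is open at every `θ`. -/
lemma gibbsMean_mem_interior (hfull : affineSpan ℝ (convexHull ℝ (𝒴 : Set (Vec d))) = ⊤)
    (ht : 0 < t) (θ : Vec d) :
    gibbsMean 𝒴 φ t θ ∈ interior (convexHull ℝ (𝒴 : Set (Vec d))) := by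
  rw [mem_interior_iff_mem_nhds,
    ← (hasStrictFDerivAt_gibbsMean_covEquiv (φ := φ) hfull ht θ).map_nhds_eq_of_equiv]
  exact mem_map.2 <| Eventually.of_forall
    fun θ' => gibbsMean_mem_convexHull (nonempty_of_affineSpan_eq_top hfull) θ'

/-- The delta-method linear map `t Cov⁻¹` turns the Gaussian limit of the sample mean into the one
with covariance matrix `t² Cov⁻¹`. -/
lemma map_covEquiv_symm_multivariateGaussian
    (hfull : affineSpan ℝ (convexHull ℝ (𝒴 : Set (Vec d))) = ⊤) (ht : 0 < t) (θ : Vec d) :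
    (multivariateGaussian 0 (covMat (gibbs 𝒴 φ t θ))).map (covEquiv hfull φ ht θ).symm =
      multivariateGaussian 0 (t ^ 2 • (covMat (gibbs 𝒴 φ t θ))⁻¹) := by
  have hS := posDef_covMat_gibbs (φ := φ) (t := t) hfull θ
  set S := covMat (gibbs 𝒴 φ t θ) with hSdef
  have hu := (Matrix.isUnit_iff_isUnit_det _).1 hS.isUnit
  have hT : (t ^ 2 • S⁻¹).PosDef := hS.inv.smul (by positivity)
  have hsymm : (S⁻¹).transpose = S⁻¹ := by
    have := hS.inv.1
    rwa [Matrix.IsHermitian, Matrix.conjTranspose_eq_transpose_of_trivial] at this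
  have := Measure.isProbabilityMeasure_map (μ := multivariateGaussian 0 S)
    (f := (covEquiv hfull φ ht θ).symm) (by fun_prop)
  refine Measure.ext_of_charFun (funext fun x => ?_)
  set w : Vec d := t • Matrix.toEuclideanCLM (n := Fin d) (𝕜 := ℝ) S⁻¹ x with hw
  have hadj : ∀ z, inner ℝ ((covEquiv hfull φ ht θ).symm z) x = inner ℝ z w := by
    intro z
    change inner ℝ (t • Matrix.toEuclideanCLM (n := Fin d) (𝕜 := ℝ) S⁻¹ z) x = _
    rw [hw, inner_smul_left, inner_smul_right, Matrix.inner_toEuclideanCLM, real_inner_comm,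
      Matrix.inner_toEuclideanCLM, Matrix.dotProduct_mulVec, ← Matrix.mulVec_transpose, hsymm,
      dotProduct_comm]
    rfl
  have h1 : charFun ((multivariateGaussian 0 S).map (covEquiv hfull φ ht θ).symm) x =
      charFun (multivariateGaussian 0 S) w := by
    rw [charFun_apply, charFun_apply, integral_map (by fun_prop) (by fun_prop)]
    simp only [hadj]
  rw [h1, charFun_multivariateGaussian hS.posSemidef, charFun_multivariateGaussian hT.posSemidef]
  have h2 : dotProduct w.ofLp (S.mulVec w.ofLp) =
      dotProduct x.ofLp ((t ^ 2 • S⁻¹).mulVec x.ofLp) := by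
    have hw' : w.ofLp = t • S⁻¹.mulVec x.ofLp := rfl
    rw [hw', Matrix.mulVec_smul, Matrix.mulVec_mulVec, Matrix.mul_nonsing_inv _ hu,
      Matrix.one_mulVec, dotProduct_smul, smul_dotProduct, Matrix.smul_mulVec, dotProduct_smul,
      dotProduct_comm, smul_eq_mul, smul_eq_mul, smul_eq_mul]
    ring
  rw [h2]
  simp

end

section

/-! ### The delta method and the asymptotics of the minimizer -/

/-- The delta method, for estimators `W n` that need to agree with `g (T n)` only almost surely for
large `n`. -/
theorem tendstoInDistribution_delta_method {E F Ω Ω' : Type*} [NormedAddCommGroup E]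
    [NormedSpace ℝ E] [MeasurableSpace E] [BorelSpace E] [SecondCountableTopology E]
    [NormedAddCommGroup F] [NormedSpace ℝ F] [MeasurableSpace F] [BorelSpace F]
    [SecondCountableTopology F] [MeasurableSpace Ω] {P : Measure Ω} [IsProbabilityMeasure P]
    [MeasurableSpace Ω'] {P' : Measure Ω'} [IsProbabilityMeasure P'] {Z : Ω' → E}
    {r : ℕ → ℝ} {T : ℕ → Ω → E} {W : ℕ → Ω → F} {a : E} {g : E → F} {g' : E →L[ℝ] F}
    (hTZ : TendstoInDistribution (fun n ω => r n • (T n ω - a)) atTop Z (fun _ => P) P')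
    (hT : ∀ᵐ ω ∂P, Tendsto (fun n => T n ω) atTop (𝓝 a)) (hg : HasFDerivAt g g' a)
    (hW : ∀ n, AEMeasurable (W n) P) (hWg : ∀ᵐ ω ∂P, ∀ᶠ n in atTop, W n ω = g (T n ω)) :
    TendstoInDistribution (fun n ω => r n • (W n ω - g a)) atTop (fun ω => g' (Z ω))
      (fun _ => P) P' := by
  set X : ℕ → Ω → E := fun n ω => r n • (T n ω - a) with hX
  clear_value X
  -- The linearization error, rescaled so that it tends to zero almost surely even though the
  -- fluctuations `X n` need not be bounded almost surely.
  set C : ℕ → Ω → F := fun n ω => (1 + ‖X n ω‖)⁻¹ • (r n • (W n ω - g a) - g' (X n ω)) with hC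
  have hXm : ∀ n, AEMeasurable (X n) P := hTZ.forall_aemeasurable
  have hCm : ∀ n, AEMeasurable (C n) P := fun n => by
    have h1 := hXm n
    have h2 := hW n
    have h3 : AEMeasurable (fun ω => g' (X n ω)) P := g'.continuous.measurable.comp_aemeasurable h1
    exact ((aemeasurable_const.add h1.norm).inv).smul (((h2.sub_const _).const_smul _).sub h3)
  have hC0 : ∀ᵐ ω ∂P, Tendsto (fun n => C n ω) atTop (𝓝 0) := by
    filter_upwards [hT, hWg] with ω hω hWω
    rw [Metric.tendsto_nhds]
    intro ε hε
    have ho := hω.eventually ((Asymptotics.isLittleO_iff.1 hg.isLittleO) (half_pos hε))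
    filter_upwards [ho, hWω] with n hn hWn
    have hpos : 0 < 1 + ‖X n ω‖ := by positivity
    have hD : r n • (W n ω - g a) - g' (X n ω) =
        r n • (g (T n ω) - g a - g' (T n ω - a)) := by
      rw [hWn, hX, map_smul, ← smul_sub]
    rw [dist_zero_right, hC]
    simp only [hD]
    rw [norm_smul, norm_smul, norm_inv, Real.norm_of_nonneg hpos.le, inv_mul_lt_iff₀ hpos]
    calc ‖r n‖ * ‖g (T n ω) - g a - g' (T n ω - a)‖ ≤ ‖r n‖ * (ε / 2 * ‖T n ω - a‖) := by gcongr
      _ = ε / 2 * ‖X n ω‖ := by rw [hX, norm_smul]; ring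
      _ < (1 + ‖X n ω‖) * ε := by nlinarith [norm_nonneg (X n ω)]
  have hmeas := tendstoInMeasure_of_tendsto_ae (fun n => (hCm n).aestronglyMeasurable) hC0
  have h := hTZ.continuous_comp_prodMk_of_tendstoInMeasure_const
    (g := fun p : E × F => g' p.1 + (1 + ‖p.1‖) • p.2) (by fun_prop) hmeas hCm
  refine h.congr (fun n => Eventually.of_forall fun ω => ?_) (Eventually.of_forall fun ω => ?_)
  · have hpos : 1 + ‖X n ω‖ ≠ 0 := by positivity
    simp only [hC, smul_smul, mul_inv_cancel₀ hpos, one_smul, add_sub_cancel]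
  · simp

variable {d : ℕ} {𝒴 : Finset (Vec d)} {φ : Vec d → ℝ} {t : ℝ}

lemma sampleMean_eq {Ω : Type*} (y : ℕ → Ω → Vec d) (N : ℕ) (ω : Ω) :
    sampleMean (fun i : Fin N => y i ω) = (N : ℝ)⁻¹ • ∑ i ∈ Finset.range N, y i ω := by
  rw [sampleMean, one_div, Finset.sum_range]

section IID

variable {Ω : Type*} [MeasurableSpace Ω] {P : Measure Ω} {θ₀ : Vec d}
  {y : ℕ → Ω → Vec d}

lemma ae_forall_mem (hy_meas : ∀ i, Measurable (y i))
    (hy_law : ∀ i, P.map (y i) = gibbs 𝒴 φ t θ₀) : ∀ᵐ ω ∂P, ∀ i, y i ω ∈ 𝒴 :=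
  ae_all_iff.2 fun i => ae_of_ae_map (hy_meas i).aemeasurable
    (by rw [hy_law i]; exact ae_mem_gibbs θ₀)

lemma ae_tendsto_sampleMean (hne : 𝒴.Nonempty) (hy_meas : ∀ i, Measurable (y i))
    (hy_indep : iIndepFun y P) (hy_law : ∀ i, P.map (y i) = gibbs 𝒴 φ t θ₀) :
    ∀ᵐ ω ∂P, Tendsto (fun N : ℕ => sampleMean (fun i : Fin N => y i ω)) atTop
      (𝓝 (gibbsMean 𝒴 φ t θ₀)) := by
  have := isProbabilityMeasure_gibbs (φ := φ) (t := t) hne θ₀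
  have hint : Integrable (y 0) P := by
    have h := (memLp_id_gibbs (φ := φ) (t := t) hne θ₀).integrable (by norm_num)
    rw [← hy_law 0] at h
    exact h.comp_measurable (hy_meas 0)
  have hmean : ∫ ω, y 0 ω ∂P = gibbsMean 𝒴 φ t θ₀ := by
    rw [← integral_id_gibbs hne, ← hy_law 0,
      integral_map (hy_meas 0).aemeasurable (by fun_prop)]
  have h := strong_law_ae y hint (fun i j hij => hy_indep.indepFun hij)
    fun i => ⟨(hy_meas i).aemeasurable, (hy_meas 0).aemeasurable, by rw [hy_law, hy_law]⟩
  simpa only [sampleMean_eq, hmean] using h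

lemma tendstoInDistribution_sampleMean [IsProbabilityMeasure P] (hne : 𝒴.Nonempty)
    (hy_meas : ∀ i, Measurable (y i))
    (hy_indep : iIndepFun y P) (hy_law : ∀ i, P.map (y i) = gibbs 𝒴 φ t θ₀) :
    TendstoInDistribution
      (fun (N : ℕ) ω => √(N : ℝ) • (sampleMean (fun i : Fin N => y i ω) - gibbsMean 𝒴 φ t θ₀))
      atTop (id : Vec d → Vec d) (fun _ => P)
      (multivariateGaussian 0 (covMat (gibbs 𝒴 φ t θ₀))) := by
  have := isProbabilityMeasure_gibbs (φ := φ) (t := t) hne θ₀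
  have h := tendstoInDistribution_inv_sqrt_smul_sum_sub hy_meas hy_indep hy_law
    (memLp_id_gibbs hne θ₀)
  refine h.congr (fun N => Eventually.of_forall fun ω => ?_) (Eventually.of_forall fun _ => rfl)
  simp only [sampleMean_eq, integral_id_gibbs hne]
  rcases Nat.eq_zero_or_pos N with rfl | hN
  · simp
  have hs : (√(N : ℝ)) ≠ 0 := by positivity
  have hsq : (N : ℝ) = √(N : ℝ) * √(N : ℝ) := (Real.mul_self_sqrt (by positivity)).symm
  have h1 : √(N : ℝ) * (N : ℝ)⁻¹ = (√(N : ℝ))⁻¹ := by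
    nth_rewrite 2 [hsq]
    field_simp
  have h2 : (√(N : ℝ))⁻¹ * N = √(N : ℝ) := by
    nth_rewrite 2 [hsq]
    field_simp
  rw [smul_sub, smul_sub, smul_smul, smul_smul, h1, h2]

/-- By injectivity of the Gibbs mean, a minimizer is the image of the sample mean under the local
inverse of the Gibbs mean at `θ₀`; the delta method then applies. -/
theorem tendstoInDistribution_isMinimizer [IsProbabilityMeasure P]
    (hfull : affineSpan ℝ (convexHull ℝ (𝒴 : Set (Vec d))) = ⊤) (ht : 0 < t)
    (hy_meas : ∀ i, Measurable (y i)) (hy_indep : iIndepFun y P)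
    (hy_law : ∀ i, P.map (y i) = gibbs 𝒴 φ t θ₀) {θstar : ℕ → Ω → Vec d}
    (hθ_meas : ∀ N, AEMeasurable (θstar N) P)
    (hθ : ∀ N : ℕ, 0 < N → ∀ᵐ ω ∂P, sampleMean (fun i : Fin N => y i ω) ∈
      interior (convexHull ℝ (𝒴 : Set (Vec d))) →
      IsMinimizer 𝒴 φ t (fun i : Fin N => y i ω) (θstar N ω)) :
    TendstoInDistribution (fun (N : ℕ) ω => √(N : ℝ) • (θstar N ω - θ₀)) atTop
      (id : Vec d → Vec d) (fun _ => P)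
      (multivariateGaussian 0 (t ^ 2 • (covMat (gibbs 𝒴 φ t θ₀))⁻¹)) := by
  have hne := nonempty_of_affineSpan_eq_top hfull
  have hderiv := hasStrictFDerivAt_gibbsMean_covEquiv (φ := φ) hfull ht θ₀
  have hmean := ae_tendsto_sampleMean hne hy_meas hy_indep hy_law
  have hloc : ∀ᵐ ω ∂P, ∀ᶠ N in atTop, θstar N ω =
      hderiv.localInverse _ _ _ (sampleMean (fun i : Fin N => y i ω)) := by
    have hθ' : ∀ᵐ ω ∂P, ∀ N : ℕ, 0 < N → sampleMean (fun i : Fin N => y i ω) ∈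
        interior (convexHull ℝ (𝒴 : Set (Vec d))) →
        IsMinimizer 𝒴 φ t (fun i : Fin N => y i ω) (θstar N ω) :=
      ae_all_iff.2 fun N => by
        rcases Nat.eq_zero_or_pos N with rfl | hN
        · simp
        · filter_upwards [hθ N hN] with ω hω _ using hω
    filter_upwards [hθ', hmean, ae_forall_mem hy_meas hy_law] with ω h1 h2 h3
    filter_upwards [eventually_gt_atTop 0,
      h2.eventually (isOpen_interior.mem_nhds (gibbsMean_mem_interior (φ := φ) hfull ht θ₀)),
      h2.eventually hderiv.eventually_right_inverse] with N hN hint hinv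
    refine gibbsMean_injective (φ := φ) hfull ht ?_
    rw [hinv, (isMinimizer_iff_gibbsMean_eq hne ht hN fun i : Fin N => h3 i).1 (h1 N hN hint)]
  have h := tendstoInDistribution_delta_method
    (tendstoInDistribution_sampleMean hne hy_meas hy_indep hy_law) hmean
    hderiv.to_localInverse.hasFDerivAt hθ_meas hloc
  rw [hderiv.localInverse_apply_image] at h
  refine ⟨fun N => by have := hθ_meas N; fun_prop, aemeasurable_id, ?_⟩
  convert h.tendsto using 2
  refine congrArg 𝓝 (Subtype.ext ?_)
  change Measure.map id _ = Measure.map (covEquiv hfull φ ht θ₀).symm _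
  rw [Measure.map_id, map_covEquiv_symm_multivariateGaussian]

end IID

end

end

end FYGibbs

theorem proposition4p2 {d : ℕ} (𝒴 : Finset (FYGibbs.Vec d))
    (hfull : affineSpan ℝ (convexHull ℝ (𝒴 : Set (FYGibbs.Vec d))) = ⊤)
    (φ : FYGibbs.Vec d → ℝ) (t : ℝ) (ht : 0 < t) (θ₀ : FYGibbs.Vec d)
    {Ω : Type*} [MeasurableSpace Ω] (P : Measure Ω) [IsProbabilityMeasure P]
    (y : ℕ → Ω → FYGibbs.Vec d) (hy_meas : ∀ i, Measurable (y i))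
    (hy_indep : iIndepFun y P)
    (hy_law : ∀ i, P.map (y i) = FYGibbs.gibbs 𝒴 φ t θ₀) :
    -- the covariance matrix is positive definite, so its inverse is a genuine covariance matrix
    (FYGibbs.covMat (FYGibbs.gibbs 𝒴 φ t θ₀)).PosDef ∧
    -- the empirical loss minimizer exists and is unique when the sample mean is interior
    (∀ (N : ℕ), 0 < N → ∀ u : Fin N → FYGibbs.Vec d, (∀ i, u i ∈ 𝒴) →
      FYGibbs.sampleMean u ∈ interior (convexHull ℝ (𝒴 : Set (FYGibbs.Vec d))) →
      ∃! θ : FYGibbs.Vec d, FYGibbs.IsMinimizer 𝒴 φ t u θ) ∧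
    -- almost surely, the sample mean is interior for all large `N`
    (∀ᵐ ω ∂P, ∀ᶠ N : ℕ in atTop,
      FYGibbs.sampleMean (fun i : Fin N => y i ω) ∈
        interior (convexHull ℝ (𝒴 : Set (FYGibbs.Vec d)))) ∧
    -- asymptotic normality of the empirical loss minimizer
    (∀ θstar : ℕ → Ω → FYGibbs.Vec d,
      (∀ N, AEMeasurable (θstar N) P) →
      (∀ N : ℕ, 0 < N → ∀ᵐ ω ∂P,
        FYGibbs.sampleMean (fun i : Fin N => y i ω) ∈
          interior (convexHull ℝ (𝒴 : Set (FYGibbs.Vec d))) →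
        FYGibbs.IsMinimizer 𝒴 φ t (fun i : Fin N => y i ω) (θstar N ω)) →
      TendstoInDistribution (fun (N : ℕ) ω => √(N : ℝ) • (θstar N ω - θ₀)) atTop
        (id : FYGibbs.Vec d → FYGibbs.Vec d) (fun _ => P)
        (multivariateGaussian 0 (t ^ 2 • (FYGibbs.covMat (FYGibbs.gibbs 𝒴 φ t θ₀))⁻¹))) := by
  refine ⟨FYGibbs.posDef_covMat_gibbs hfull θ₀, fun N hN u hu hint =>
    FYGibbs.existsUnique_isMinimizer hfull ht hN hu hint, ?_, fun θstar hθ_meas hθ =>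
    FYGibbs.tendstoInDistribution_isMinimizer hfull ht hy_meas hy_indep hy_law hθ_meas hθ⟩
  filter_upwards [FYGibbs.ae_tendsto_sampleMean
    (FYGibbs.nonempty_of_affineSpan_eq_top hfull) hy_meas hy_indep hy_law] with ω hω
  exact hω.eventually (isOpen_interior.mem_nhds (FYGibbs.gibbsMean_mem_interior hfull ht θ₀))
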